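/- Let $\mathcal P\subset\mathbb R^r$ be a convex polytope (the convex hull of finitely many points) with vertex set $\mathrm{ext}(\mathcal P)$. If $\mathrm{ext}(\mathcal P)$ is permutation-and/or-sign-only invariant, then $\mathcal P$ is Det-Max identifiable. If moreover $\mathcal P$ admits at least one sufficiently scattered factor, then $\mathcal P$ is Det-Max identifiable if and only if $\mathrm{ext}(\mathcal P)$ is permutation-and/or-sign-only invariant. Here the notions are as follows. For $\mathcal X\subseteq\mathbb R^r$ and $\mathbf d\in\mathbb R^r$, the polar is $\mathcal X^{*,\mathbf d}=\{\mathbf x : \langle \mathbf x,\mathbf y-\mathbf d\rangle\le 1\ \forall\,\mathbf y\in\mathcal X\}$; $\mathrm{conv}(\mathbf S)$ is the convex hull of the columns of $\mathbf S$, $\mathrm{bd}$ denotes the boundary, and $\mathrm{ext}$ the set of extreme points. The maximum volume inscribed ellipsoid of $\mathcal P$ is $\mathcal E_{\mathcal P}=\{\mathbf C_{\mathcal P}\mathbf u+\mathbf g_{\mathcal P} : \|\mathbf u\|_2\le 1\}\subseteq\mathcal P$ with $\mathbf C_{\mathcal P}\succ 0$ and $\det\mathbf C_{\mathcal P}$ maximal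 among all ellipsoids $\{\mathbf C\mathbf u+\mathbf g : \|\mathbf u\|_2\le 1\}\subseteq\mathcal P$, $\mathbf C\succeq 0$. A matrix $\mathbf S\in\mathbb R^{r\times N}$ is a sufficiently scattered factor for $\mathcal P$ if $\mathcal P$ has such an ellipsoid and (i) $\mathcal P\supseteq\mathrm{conv}(\mathbf S)\supseteq\mathcal E_{\mathcal P}$, and (ii) $\mathrm{conv}(\mathbf S)^{*,\mathbf g_{\mathcal P}}\cap\mathrm{bd}(\mathcal E_{\mathcal P}^{*,\mathbf g_{\mathcal P}})=\mathrm{ext}(\mathcal P^{*,\mathbf g_{\mathcal P}})$. A generative model is $\mathbf Y=\mathbf H_g\mathbf S_g$ with $\mathbf H_g\in\mathbb R^{M\times r}$ of full column rank, $\mathbf S_g\in\mathbb R^{r\times N}$ with all columns in $\mathcal P$, and $r\le\min(M,N)$. Its Det-Max problem is to maximize $\det(\mathbf S\mathbf S^T)$ over all $\mathbf H\in\mathbb R^{M\times r}$, $\mathbf S\in\mathbb R^{r\times N}$ with $\mathbf Y=\mathbf H\mathbf S$ and all columns of $\mathbf S$ in $\mathcal P$. $\mathcal P$ is Det-Max identifiable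 if, for every generative model (any $M,N$) in which $\mathbf S_g$ is a sufficiently scattered factor for $\mathcal P$, every global optimum $(\mathbf H,\mathbf S)$ of the Det-Max problem satisfies $\mathbf H=\mathbf H_g\boldsymbol\Pi^T\mathbf D^{-1}$ and $\mathbf S=\mathbf D\boldsymbol\Pi\mathbf S_g$ for some permutation matrix $\boldsymbol\Pi$ and some diagonal matrix $\mathbf D$ with diagonal entries in $\{-1,1\}$. A set $\mathcal F\subseteq\mathbb R^r$ is permutation-and/or-sign-only invariant if every $\mathbf A\in\mathbb R^{r\times r}$ with $\mathbf A(\mathcal F)=\mathcal F$ has the form $\mathbf A=\boldsymbol\Pi\mathbf D$ with $\boldsymbol\Pi$ a permutation matrix and $\mathbf D$ a diagonal matrix with diagonal entries in $\{-1,1\}$. -/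

import Mathlib

open scoped Matrix

/-- Vectors of `ℝ^r` are functions `Fin r → ℝ`; the Euclidean inner product is the dot product
`x ⬝ᵥ y`, and `x ⬝ᵥ x` is the square of the Euclidean norm.
A convex polytope is the convex hull of finitely many points. -/
def IsPolytope {r : ℕ} (P : Set (Fin r → ℝ)) : Prop :=
  ∃ V : Set (Fin r → ℝ), V.Finite ∧ P = convexHull ℝ V

/-- `conv(S)`: the convex hull of the columns of `S`. -/
def convCols {r N : ℕ} (S : Matrix (Fin r) (Fin N) ℝ) : Set (Fin r → ℝ) :=
  convexHull ℝ (Set.range S.col)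

/-- The ellipsoid `{C u + g : ‖u‖₂ ≤ 1}`. -/
def ellipsoid {r : ℕ} (C : Matrix (Fin r) (Fin r) ℝ) (g : Fin r → ℝ) : Set (Fin r → ℝ) :=
  {x | ∃ u : Fin r → ℝ, u ⬝ᵥ u ≤ 1 ∧ x = C *ᵥ u + g}

/-- `ellipsoid C g` is the maximum volume inscribed ellipsoid of `P`: it is nondegenerate, it lies
in `P`, and `det C` (to which the volume is proportional) is maximal among the ellipsoids
`ellipsoid C' g'` contained in `P` with `C'` positive semidefinite. -/
structure IsMVIE {r : ℕ} (P : Set (Fin r → ℝ)) (C : Matrix (Fin r) (Fin r) ℝ)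
    (g : Fin r → ℝ) : Prop where
  posDef : C.PosDef
  subset : ellipsoid C g ⊆ P
  maximal : ∀ (C' : Matrix (Fin r) (Fin r) ℝ) (g' : Fin r → ℝ), C'.PosSemidef →
    ellipsoid C' g' ⊆ P → C'.det ≤ C.det

/-- The polar `X^{*,d}` of the set `X` with respect to the point `d`. -/
def polarAt {r : ℕ} (X : Set (Fin r → ℝ)) (d : Fin r → ℝ) : Set (Fin r → ℝ) :=
  {x | ∀ y ∈ X, x ⬝ᵥ (y - d) ≤ 1}

/-- `S` is a sufficiently scattered factor for `P`. -/
def IsSufficientlyScattered {r N : ℕ} (P : Set (Fin r → ℝ))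
    (S : Matrix (Fin r) (Fin N) ℝ) : Prop :=
  ∃ (C : Matrix (Fin r) (Fin r) ℝ) (g : Fin r → ℝ), IsMVIE P C g ∧
    convCols S ⊆ P ∧ ellipsoid C g ⊆ convCols S ∧
    polarAt (convCols S) g ∩ frontier (polarAt (ellipsoid C g) g) =
      Set.extremePoints ℝ (polarAt P g)

/-- Generative model `Y = Hg * Sg`: `Hg` has full column rank, `r ≤ min M N`, and the columns of
`Sg` lie in `P`. -/
structure IsGenerativeModel {M N r : ℕ} (P : Set (Fin r → ℝ)) (Y : Matrix (Fin M) (Fin N) ℝ)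
    (Hg : Matrix (Fin M) (Fin r) ℝ) (Sg : Matrix (Fin r) (Fin N) ℝ) : Prop where
  eq_mul : Y = Hg * Sg
  rank_eq : Hg.rank = r
  le_min : r ≤ min M N
  col_mem : ∀ j, Sg.col j ∈ P

/-- The constraints of the Det-Max optimization problem with data `Y` and `P`. -/
def IsFeasible {M N r : ℕ} (P : Set (Fin r → ℝ)) (Y : Matrix (Fin M) (Fin N) ℝ)
    (H : Matrix (Fin M) (Fin r) ℝ) (S : Matrix (Fin r) (Fin N) ℝ) : Prop :=
  Y = H * S ∧ ∀ j, S.col j ∈ P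

/-- `(H, S)` is a global optimum of the Det-Max problem: maximize `det (S Sᵀ)` over the feasible
pairs. -/
def IsDetMaxOptimum {M N r : ℕ} (P : Set (Fin r → ℝ)) (Y : Matrix (Fin M) (Fin N) ℝ)
    (H : Matrix (Fin M) (Fin r) ℝ) (S : Matrix (Fin r) (Fin N) ℝ) : Prop :=
  IsFeasible P Y H S ∧
    ∀ (H' : Matrix (Fin M) (Fin r) ℝ) (S' : Matrix (Fin r) (Fin N) ℝ),
      IsFeasible P Y H' S' → (S' * S'ᵀ).det ≤ (S * Sᵀ).det

/-- A diagonal matrix with diagonal entries in `{-1, 1}`. -/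
def IsSignDiagonal {r : ℕ} (D : Matrix (Fin r) (Fin r) ℝ) : Prop :=
  ∃ d : Fin r → ℝ, (∀ i, d i = 1 ∨ d i = -1) ∧ D = Matrix.diagonal d

/-- Every optimum of the Det-Max problem equals the ground truth up to permutation and sign. -/
def IsDetMaxIdentifiableSetting {M N r : ℕ} (P : Set (Fin r → ℝ)) (Y : Matrix (Fin M) (Fin N) ℝ)
    (Hg : Matrix (Fin M) (Fin r) ℝ) (Sg : Matrix (Fin r) (Fin N) ℝ) : Prop :=
  ∀ (H : Matrix (Fin M) (Fin r) ℝ) (S : Matrix (Fin r) (Fin N) ℝ), IsDetMaxOptimum P Y H S →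
    ∃ (σ : Equiv.Perm (Fin r)) (D : Matrix (Fin r) (Fin r) ℝ), IsSignDiagonal D ∧
      H = Hg * (σ.permMatrix ℝ)ᵀ * D⁻¹ ∧ S = D * σ.permMatrix ℝ * Sg

/-- `P` is Det-Max identifiable: all generative models with a sufficiently scattered factor from
`P` are Det-Max identifiable settings. -/
def IsDetMaxIdentifiable {r : ℕ} (P : Set (Fin r → ℝ)) : Prop :=
  ∀ (M N : ℕ) (Y : Matrix (Fin M) (Fin N) ℝ) (Hg : Matrix (Fin M) (Fin r) ℝ)
    (Sg : Matrix (Fin r) (Fin N) ℝ), IsGenerativeModel P Y Hg Sg →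
      IsSufficientlyScattered P Sg → IsDetMaxIdentifiableSetting P Y Hg Sg

/-- `F` is permutation-and/or-sign-only invariant. -/
def IsPermSignOnlyInvariant {r : ℕ} (F : Set (Fin r → ℝ)) : Prop :=
  ∀ A : Matrix (Fin r) (Fin r) ℝ, (fun x => A *ᵥ x) '' F = F →
    ∃ (σ : Equiv.Perm (Fin r)) (D : Matrix (Fin r) (Fin r) ℝ), IsSignDiagonal D ∧
      A = σ.permMatrix ℝ * D

/-! ### Uniqueness of the maximum volume inscribed ellipsoid. -/

section Ellipsoids

variable {r : ℕ}

/-! Everything rests on the matrix `A` with `S = A * Sg` and `H = Hg * A⁻¹` relating an optimum to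
the ground truth. Comparison with the ground truth gives `1 ≤ |det A|`. Since `P` contains the
`A`-image of `conv(Sg)`, hence of the ellipsoid `E`, maximality of `E` gives `|det A| ≤ 1`, and
uniqueness of `E` (`IsMVIE.eq_of_image_subset`) gives `A E = E` and `A g = g`.

By duality, `x ↦ x ᵥ* A` preserves the boundary of the polar of `E` and carries the polar of `P`
into that of `conv(Sg)`. Condition (ii) then makes it map the extreme points of the polar of `P` to
themselves. They are finitely many, so this injective map permutes them; separation turns this into
`A P = P`, and `A` permutes the vertices (`image_extremePoints_eq_of_col_mem`).

Conversely, if `A` preserves the vertices and `S` is sufficiently scattered, then `(A⁻¹, A * S)` is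
an optimum for `Y = S`, so identifiability forces `A` to be a signed permutation. -/

theorem dotProduct_mulVec_self_of_transpose_mul_eq_one {Q : Matrix (Fin r) (Fin r) ℝ}
    (hQ : Qᵀ * Q = 1) (u : Fin r → ℝ) : (Q *ᵥ u) ⬝ᵥ (Q *ᵥ u) = u ⬝ᵥ u := by
  rw [Matrix.dotProduct_mulVec, ← Matrix.mulVec_transpose, Matrix.mulVec_mulVec, hQ,
    Matrix.one_mulVec]

/-- The ellipsoid with matrix `M` depends on `M * Mᵀ` only. -/
theorem ellipsoid_subset_of_mul_transpose_eq {M M' : Matrix (Fin r) (Fin r) ℝ}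
    (hM' : IsUnit M'.det) (h : M * Mᵀ = M' * M'ᵀ) (g : Fin r → ℝ) :
    ellipsoid M g ⊆ ellipsoid M' g := by
  rintro x ⟨u, hu, rfl⟩
  have hQ : (M'⁻¹ * M) * (M'⁻¹ * M)ᵀ = 1 := by
    have h' : IsUnit M'ᵀ.det := by rwa [Matrix.det_transpose]
    rw [Matrix.transpose_mul, Matrix.transpose_nonsing_inv, Matrix.mul_assoc,
      ← Matrix.mul_assoc M, h, Matrix.mul_assoc, Matrix.mul_nonsing_inv _ h', Matrix.mul_one,
      Matrix.nonsing_inv_mul _ hM']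
  refine ⟨(M'⁻¹ * M) *ᵥ u, ?_, ?_⟩
  · rw [dotProduct_mulVec_self_of_transpose_mul_eq_one (mul_eq_one_comm.1 hQ)]
    exact hu
  · rw [Matrix.mulVec_mulVec, ← Matrix.mul_assoc, Matrix.mul_nonsing_inv _ hM', Matrix.one_mul]

/-- An invertible matrix has the same Gram matrix of rows as an orthogonal matrix times a positive
diagonal one. -/
theorem exists_orthogonal_diagonal {M : Matrix (Fin r) (Fin r) ℝ} (hM : M.det ≠ 0) :
    ∃ (U : Matrix (Fin r) (Fin r) ℝ) (l : Fin r → ℝ), U * Uᵀ = 1 ∧ (∀ i, 0 < l i) ∧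
      M * Mᵀ = (U * Matrix.diagonal l) * (U * Matrix.diagonal l)ᵀ := by
  have hpd : (M * Mᵀ).PosDef := by
    have := Matrix.PosDef.mul_conjTranspose_self M
      (Matrix.vecMul_injective_iff_isUnit.2 ((Matrix.isUnit_iff_isUnit_det _).2 hM.isUnit))
    rwa [Matrix.conjTranspose_eq_transpose_of_trivial] at this
  have hH := hpd.isHermitian
  refine ⟨hH.eigenvectorUnitary, fun i => √(hH.eigenvalues i), ?_, fun i =>
    Real.sqrt_pos.2 (hpd.eigenvalues_pos i), ?_⟩
  · have := Unitary.mul_star_self_of_mem hH.eigenvectorUnitary.2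
    rwa [Matrix.star_eq_conjTranspose, Matrix.conjTranspose_eq_transpose_of_trivial] at this
  · have h := hH.spectral_theorem
    rw [Unitary.conjStarAlgAut_apply, Matrix.star_eq_conjTranspose,
      Matrix.conjTranspose_eq_transpose_of_trivial] at h
    refine h.trans ?_
    rw [Matrix.transpose_mul, Matrix.diagonal_transpose, Matrix.mul_assoc, Matrix.mul_assoc,
      ← Matrix.mul_assoc (Matrix.diagonal _) (Matrix.diagonal _), Matrix.diagonal_mul_diagonal]
    congr 3
    funext i
    simp [Real.mul_self_sqrt (hpd.eigenvalues_pos i).le]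

theorem abs_det_eq_of_mul_transpose_eq {M M' : Matrix (Fin r) (Fin r) ℝ}
    (h : M * Mᵀ = M' * M'ᵀ) : |M.det| = |M'.det| := by
  have := congrArg Matrix.det h
  rw [Matrix.det_mul, Matrix.det_mul, Matrix.det_transpose, Matrix.det_transpose] at this
  exact abs_eq_abs.2 (mul_self_eq_mul_self_iff.1 this)

theorem abs_det_eq_one_of_mul_transpose_eq_one {U : Matrix (Fin r) (Fin r) ℝ}
    (h : U * Uᵀ = 1) : |U.det| = 1 := by
  have := abs_det_eq_of_mul_transpose_eq (M := U) (M' := 1) (by simpa using h)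
  simpa using this

theorem IsMVIE.det_pos {P : Set (Fin r → ℝ)} {C : Matrix (Fin r) (Fin r) ℝ} {g : Fin r → ℝ}
    (h : IsMVIE P C g) : 0 < C.det := h.posDef.det_pos

/-- Maximality among all inscribed ellipsoids, whatever matrix describes them. -/
theorem IsMVIE.abs_det_le {P : Set (Fin r → ℝ)} {C M : Matrix (Fin r) (Fin r) ℝ}
    {g h : Fin r → ℝ} (hC : IsMVIE P C g) (hM : ellipsoid M h ⊆ P) : |M.det| ≤ C.det := by
  by_cases h0 : M.det = 0
  · rw [h0, abs_zero]
    exact hC.det_pos.le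
  obtain ⟨U, l, hU, hl, hMU⟩ := exists_orthogonal_diagonal h0
  -- Polar decomposition: `U * diagonal l * Uᵀ` is the positive square root of `M * Mᵀ`, so it
  -- describes the same ellipsoid and `maximal` applies to it.
  have hpd : (U * Matrix.diagonal l * Uᵀ).PosSemidef := by
    have := (Matrix.PosSemidef.diagonal (n := Fin r) (d := l) fun i => (hl i).le)
      |>.mul_mul_conjTranspose_same U
    rwa [Matrix.conjTranspose_eq_transpose_of_trivial] at this
  have hUU : Uᵀ * U = 1 := mul_eq_one_comm.1 hU
  have hsq : (U * Matrix.diagonal l * Uᵀ) * (U * Matrix.diagonal l * Uᵀ)ᵀ = M * Mᵀ := by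
    rw [hMU, Matrix.transpose_mul _ Uᵀ, Matrix.transpose_transpose, Matrix.mul_assoc,
      ← Matrix.mul_assoc Uᵀ U, hUU, Matrix.one_mul]
  have hdet := abs_det_eq_of_mul_transpose_eq hsq
  rw [← hdet, abs_of_nonneg hpd.det_nonneg]
  exact hC.maximal _ h hpd
    ((ellipsoid_subset_of_mul_transpose_eq (Ne.isUnit h0) hsq h).trans hM)

theorem ellipsoid_midpoint_subset {P : Set (Fin r → ℝ)} (hP : Convex ℝ P)
    {M M' : Matrix (Fin r) (Fin r) ℝ} {g g' : Fin r → ℝ} (h : ellipsoid M g ⊆ P)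
    (h' : ellipsoid M' g' ⊆ P) :
    ellipsoid ((1 / 2 : ℝ) • (M + M')) ((1 / 2 : ℝ) • (g + g')) ⊆ P := by
  rintro x ⟨u, hu, rfl⟩
  have := hP (h ⟨u, hu, rfl⟩) (h' ⟨u, hu, rfl⟩) (a := 1 / 2) (b := 1 / 2) (by norm_num)
    (by norm_num) (by norm_num)
  convert this using 1
  rw [Matrix.smul_mulVec, Matrix.add_mulVec]
  module

/-- Equality case of AM-GM: `l i ≤ ((1 + l i) / 2) ^ 2`, strictly when `l i ≠ 1`. -/
theorem eq_one_of_prod_add_one_half_le {l : Fin r → ℝ} (hl : ∀ i, 0 < l i) (h1 : ∏ i, l i = 1)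
    (h2 : ∏ i, (1 + l i) / 2 ≤ 1) (i : Fin r) : l i = 1 := by
  by_contra hi
  have hlt : ∏ i, l i < ∏ i, ((1 + l i) / 2) ^ 2 := by
    refine Finset.prod_lt_prod (fun i _ => hl i) (fun i _ => ?_) ⟨i, Finset.mem_univ _, ?_⟩
    · nlinarith [sq_nonneg (1 - l i)]
    · have : 0 < (l i - 1) ^ 2 := sq_pos_of_ne_zero (sub_ne_zero.2 hi)
      nlinarith
  rw [h1, Finset.prod_pow] at hlt
  have h0 : 0 ≤ ∏ i, (1 + l i) / 2 := Finset.prod_nonneg fun i _ => by linarith [hl i]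
  exact absurd hlt (not_lt.2 (pow_le_one₀ h0 h2))

/-- Strict log-concavity of the determinant. Rotated parameters turn the two matrices into `C * U`
and `C * U * diagonal l` with `∏ l i = 1`; their average is inscribed too, and its volume would be
larger unless every `l i` is `1`. -/
theorem IsMVIE.mul_transpose_eq {P : Set (Fin r → ℝ)} (hP : Convex ℝ P)
    {C M : Matrix (Fin r) (Fin r) ℝ} {g h : Fin r → ℝ} (hC : IsMVIE P C g)
    (hM : ellipsoid M h ⊆ P) (hdet : |M.det| = C.det) : M * Mᵀ = C * Cᵀ := by
  have hC0 := hC.det_pos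
  have hCu : IsUnit C.det := hC0.ne'.isUnit
  have hCB : C * (C⁻¹ * M) = M := by
    rw [← Matrix.mul_assoc, Matrix.mul_nonsing_inv _ hCu, Matrix.one_mul]
  have hB : |(C⁻¹ * M).det| = 1 := by
    have := congrArg (fun X => |Matrix.det X|) hCB
    simp only [Matrix.det_mul C, abs_mul, hdet, abs_of_pos hC0] at this
    exact mul_left_cancel₀ hC0.ne' (this.trans (mul_one _).symm)
  have hB0 : (C⁻¹ * M).det ≠ 0 := fun h0 => by simp [h0] at hB
  obtain ⟨U, l, hU, hl, hBU⟩ := exists_orthogonal_diagonal hB0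
  have hUd := abs_det_eq_one_of_mul_transpose_eq_one hU
  have hl1 : ∏ i, l i = 1 := by
    have := abs_det_eq_of_mul_transpose_eq hBU
    rw [hB, Matrix.det_mul, abs_mul, hUd, one_mul, Matrix.det_diagonal,
      abs_of_pos (Finset.prod_pos fun i _ => hl i)] at this
    exact this.symm
  have hMu : IsUnit M.det := by
    refine Ne.isUnit fun h0 => ?_
    rw [h0, abs_zero] at hdet
    exact hC0.ne hdet
  have h1 : ellipsoid (C * U) g ⊆ P := by
    refine (ellipsoid_subset_of_mul_transpose_eq hCu ?_ g).trans hC.subset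
    rw [Matrix.transpose_mul, Matrix.mul_assoc, ← Matrix.mul_assoc U, hU, Matrix.one_mul]
  have h2 : ellipsoid (C * (U * Matrix.diagonal l)) h ⊆ P := by
    refine (ellipsoid_subset_of_mul_transpose_eq hMu ?_ h).trans hM
    rw [Matrix.transpose_mul C, Matrix.mul_assoc, ← Matrix.mul_assoc (U * Matrix.diagonal l),
      ← hBU, ← Matrix.mul_assoc, ← Matrix.mul_assoc, hCB, Matrix.mul_assoc,
      ← Matrix.transpose_mul, hCB]
  have h3 := hC.abs_det_le (ellipsoid_midpoint_subset hP h1 h2)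
  have h4 : (1 / 2 : ℝ) • (C * U + C * (U * Matrix.diagonal l)) =
      C * (U * Matrix.diagonal fun i => (1 + l i) / 2) := by
    rw [← Matrix.mul_add, ← Matrix.mul_smul]
    congr 1
    ext i j
    simp only [Matrix.smul_apply, Matrix.add_apply, Matrix.mul_diagonal, smul_eq_mul]
    ring
  have hpos : 0 ≤ ∏ i, (1 + l i) / 2 := Finset.prod_nonneg fun i _ => by linarith [hl i]
  rw [h4, Matrix.det_mul, Matrix.det_mul, abs_mul, abs_mul, hUd, one_mul, Matrix.det_diagonal,
    abs_of_pos hC0, abs_of_nonneg hpos] at h3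
  have h5 : ∏ i, (1 + l i) / 2 ≤ 1 := le_of_mul_le_mul_left (by simpa using h3) hC0
  have hl' : l = 1 := funext (eq_one_of_prod_add_one_half_le hl hl1 h5)
  have hBB : (C⁻¹ * M) * (C⁻¹ * M)ᵀ = 1 := by
    rw [hBU, hl']
    simpa using hU
  rw [← hCB, Matrix.transpose_mul C, Matrix.mul_assoc, ← Matrix.mul_assoc (C⁻¹ * M), hBB,
    Matrix.one_mul]

theorem sq_dotProduct_le (x y : Fin r → ℝ) : (x ⬝ᵥ y) ^ 2 ≤ (x ⬝ᵥ x) * (y ⬝ᵥ y) := by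
  simpa [dotProduct, sq] using Finset.sum_mul_sq_le_sq_mul_sq Finset.univ x y

theorem dotProduct_self_nonneg_real (x : Fin r → ℝ) : 0 ≤ x ⬝ᵥ x :=
  Finset.sum_nonneg fun i _ => mul_self_nonneg (x i)

/-- Two translates of one ellipsoid in a convex set leave room for a longer ellipsoid halfway. -/
theorem IsMVIE.center_eq {P : Set (Fin r → ℝ)} (hP : Convex ℝ P)
    {C : Matrix (Fin r) (Fin r) ℝ} {g h : Fin r → ℝ} (hC : IsMVIE P C g)
    (hh : ellipsoid C h ⊆ P) : h = g := by
  have hC0 := hC.det_pos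
  have hCu : IsUnit C.det := hC0.ne'.isUnit
  set a : Fin r → ℝ := C⁻¹ *ᵥ ((1 / 2 : ℝ) • (h - g)) with ha
  have hCa : C *ᵥ a = (1 / 2 : ℝ) • (h - g) := by
    rw [ha, Matrix.mulVec_mulVec, Matrix.mul_nonsing_inv _ hCu, Matrix.one_mulVec]
  by_cases ha0 : a = 0
  · rw [ha0, Matrix.mulVec_zero, eq_comm, smul_eq_zero_iff_right (by norm_num)] at hCa
    exact sub_eq_zero.1 hCa
  exfalso
  have hn := dotProduct_self_nonneg_real a
  have hn0 : 0 < a ⬝ᵥ a := lt_of_le_of_ne hn fun h0 => ha0 (dotProduct_self_eq_zero.1 h0.symm)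
  -- Any `t > 0` with `t ^ 2 * (a ⬝ᵥ a) ≤ 1` would do, since only `|s| ≤ 1` is needed below.
  set t : ℝ := 1 / (1 + a ⬝ᵥ a) with ht
  have ht0 : 0 < t := by positivity
  have ht1 : t * (1 + a ⬝ᵥ a) = 1 := by rw [ht]; field_simp
  -- The point for `u` lies on the segment from `C u + g` to `C u + h`, with weights depending
  -- linearly on `u`. This stretches the ellipsoid along the displacement and multiplies the
  -- determinant by `1 + t * (a ⬝ᵥ a) > 1`.
  have hsub : ellipsoid (C * (1 + Matrix.vecMulVec (t • a) a)) ((1 / 2 : ℝ) • (g + h)) ⊆ P := by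
    rintro x ⟨u, hu, rfl⟩
    have hcs := sq_dotProduct_le a u
    set s : ℝ := t * (a ⬝ᵥ u) with hs
    have hs1 : |s| ≤ 1 := by
      rw [← sq_le_one_iff_abs_le_one, hs, mul_pow]
      have h1 : (a ⬝ᵥ u) ^ 2 ≤ a ⬝ᵥ a := by nlinarith
      have h2 : t ≤ 1 := by nlinarith
      have h3 : t * (a ⬝ᵥ a) ≤ 1 := by nlinarith
      calc t ^ 2 * (a ⬝ᵥ u) ^ 2 ≤ t ^ 2 * (a ⬝ᵥ a) := by gcongr
        _ = t * (t * (a ⬝ᵥ a)) := by ring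
        _ ≤ 1 := by nlinarith [mul_nonneg ht0.le hn]
    obtain ⟨hs2, hs3⟩ := abs_le.1 hs1
    have := hP (hC.subset ⟨u, hu, rfl⟩) (hh ⟨u, hu, rfl⟩) (a := (1 - s) / 2) (b := (1 + s) / 2)
      (by linarith) (by linarith) (by ring)
    convert this using 1
    rw [← Matrix.mulVec_mulVec, Matrix.add_mulVec, Matrix.one_mulVec, Matrix.mulVec_add,
      Matrix.vecMulVec_mulVec]
    have : (MulOpposite.op (a ⬝ᵥ u)) • t • a = s • a := by
      ext i
      simp [hs]
      ring
    rw [this, Matrix.mulVec_smul, hCa]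
    module
  have hd := hC.abs_det_le hsub
  rw [Matrix.det_mul, Matrix.vecMulVec_eq (Fin 1), Matrix.det_one_add_replicateCol_mul_replicateRow,
    abs_mul, abs_of_pos hC0, dotProduct_smul, smul_eq_mul,
    abs_of_pos (by positivity)] at hd
  nlinarith [mul_pos hC0 (mul_pos ht0 hn0)]

/-- A linear image of the maximum volume inscribed ellipsoid that lies in `P` and has the same
volume is that ellipsoid. -/
theorem IsMVIE.eq_of_image_subset {P : Set (Fin r → ℝ)} (hP : Convex ℝ P)
    {C A : Matrix (Fin r) (Fin r) ℝ} {g : Fin r → ℝ} (hC : IsMVIE P C g)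
    (hA : ellipsoid (A * C) (A *ᵥ g) ⊆ P) (hdet : |A.det| = 1) :
    (A * C) * (A * C)ᵀ = C * Cᵀ ∧ A *ᵥ g = g := by
  have h := hC.mul_transpose_eq hP hA
    (by rw [Matrix.det_mul, abs_mul, hdet, one_mul, abs_of_pos hC.det_pos])
  refine ⟨h, hC.center_eq hP ((ellipsoid_subset_of_mul_transpose_eq ?_ h.symm _).trans hA)⟩
  refine Ne.isUnit fun h0 => ?_
  rw [Matrix.det_mul] at h0
  rcases mul_eq_zero.1 h0 with h0 | h0
  · simp [h0] at hdet
  · exact hC.det_pos.ne' h0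

theorem image_mulVec_ellipsoid (A C : Matrix (Fin r) (Fin r) ℝ) (g : Fin r → ℝ) :
    (fun x => A *ᵥ x) '' ellipsoid C g = ellipsoid (A * C) (A *ᵥ g) := by
  ext x
  constructor
  · rintro ⟨_, ⟨u, hu, rfl⟩, rfl⟩
    exact ⟨u, hu, by simp [Matrix.mulVec_add]⟩
  · rintro ⟨u, hu, rfl⟩
    exact ⟨_, ⟨u, hu, rfl⟩, by simp [Matrix.mulVec_add]⟩

end Ellipsoids

/-! ### Polars of polytopes and ellipsoids. -/

section Polars

variable {r : ℕ}

theorem polarAt_anti {X Y : Set (Fin r → ℝ)} (h : X ⊆ Y) (d : Fin r → ℝ) :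
    polarAt Y d ⊆ polarAt X d := fun _ hx y hy => hx y (h hy)

theorem isClosed_polarAt (X : Set (Fin r → ℝ)) (d : Fin r → ℝ) : IsClosed (polarAt X d) := by
  have : polarAt X d = ⋂ y ∈ X, {x | x ⬝ᵥ (y - d) ≤ 1} := by
    ext x
    simp [polarAt]
  rw [this]
  refine isClosed_biInter fun y _ => isClosed_le ?_ continuous_const
  exact continuous_id.dotProduct continuous_const

theorem convex_polarAt (X : Set (Fin r → ℝ)) (d : Fin r → ℝ) : Convex ℝ (polarAt X d) := by
  intro x hx y hy a b ha hb hab z hz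
  rw [add_dotProduct, smul_dotProduct, smul_dotProduct, smul_eq_mul, smul_eq_mul]
  nlinarith [hx z hz, hy z hz]

theorem polarAt_convexHull (V : Set (Fin r → ℝ)) (d : Fin r → ℝ) :
    polarAt (convexHull ℝ V) d = polarAt V d := by
  refine (polarAt_anti (subset_convexHull ℝ V) d).antisymm fun x hx => ?_
  have hc : Convex ℝ {y | x ⬝ᵥ (y - d) ≤ 1} := by
    intro y hy z hz a b ha hb hab
    have hy' : x ⬝ᵥ (y - d) ≤ 1 := hy
    have hz' : x ⬝ᵥ (z - d) ≤ 1 := hz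
    have : a • y + b • z - d = a • (y - d) + b • (z - d) := by
      rw [smul_sub, smul_sub]
      nth_rewrite 1 [← one_smul ℝ d, ← hab]
      module
    change x ⬝ᵥ (a • y + b • z - d) ≤ 1
    rw [this, dotProduct_add, dotProduct_smul, dotProduct_smul, smul_eq_mul, smul_eq_mul]
    nlinarith
  exact fun y hy => convexHull_min (fun v hv => hx v hv) hc hy

theorem mem_polarAt_ellipsoid {C : Matrix (Fin r) (Fin r) ℝ} {g x : Fin r → ℝ} :
    x ∈ polarAt (ellipsoid C g) g ↔ (x ᵥ* C) ⬝ᵥ (x ᵥ* C) ≤ 1 := by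
  constructor
  · intro hx
    by_contra! hn
    obtain ⟨s, hs, hsq⟩ : ∃ s : ℝ, 1 < s ∧ (x ᵥ* C) ⬝ᵥ (x ᵥ* C) = s * s :=
      ⟨√((x ᵥ* C) ⬝ᵥ (x ᵥ* C)), Real.lt_sqrt_of_sq_lt (by simpa using hn),
        (Real.mul_self_sqrt (by linarith)).symm⟩
    have hs0 : s ≠ 0 := by linarith
    -- The normalized `x ᵥ* C` is where the functional attains its maximum `s` over the unit ball.
    have := hx (C *ᵥ (s⁻¹ • (x ᵥ* C)) + g) ⟨_, ?_, rfl⟩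
    · rw [add_sub_cancel_right, Matrix.dotProduct_mulVec, dotProduct_smul, hsq, smul_eq_mul,
        inv_mul_cancel_left₀ hs0] at this
      linarith
    · rw [smul_dotProduct, dotProduct_smul, hsq, smul_eq_mul, smul_eq_mul,
        inv_mul_cancel_left₀ hs0, inv_mul_cancel₀ hs0]
  · rintro hx _ ⟨u, hu, rfl⟩
    rw [add_sub_cancel_right, Matrix.dotProduct_mulVec]
    have h1 := sq_dotProduct_le (x ᵥ* C) u
    have h2 := dotProduct_self_nonneg_real u
    have h3 := dotProduct_self_nonneg_real (x ᵥ* C)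
    nlinarith

theorem isCompact_setOf_dotProduct_self_le_one :
    IsCompact {u : Fin r → ℝ | u ⬝ᵥ u ≤ 1} := by
  refine Metric.isCompact_of_isClosed_isBounded
    (isClosed_le (continuous_id.dotProduct continuous_id) continuous_const) ?_
  refine (Metric.isBounded_closedBall (x := (0 : Fin r → ℝ)) (r := 1)).subset fun u hu => ?_
  rw [mem_closedBall_zero_iff, pi_norm_le_iff_of_nonneg zero_le_one]
  intro i
  rw [Real.norm_eq_abs, ← sq_le_one_iff_abs_le_one]
  have h1 : u i * u i ≤ u ⬝ᵥ u :=
    Finset.single_le_sum (f := fun i => u i * u i) (fun i _ => mul_self_nonneg (u i))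
      (Finset.mem_univ i)
  have h2 : u ⬝ᵥ u ≤ 1 := hu
  nlinarith

theorem IsMVIE.isCompact_polarAt {P : Set (Fin r → ℝ)} {C : Matrix (Fin r) (Fin r) ℝ}
    {g : Fin r → ℝ} (hC : IsMVIE P C g) : IsCompact (polarAt P g) := by
  have hcomp : IsCompact ((fun u : Fin r → ℝ => u ᵥ* C⁻¹) '' {u | u ⬝ᵥ u ≤ 1}) :=
    isCompact_setOf_dotProduct_self_le_one.image
      (continuous_id.matrix_vecMul continuous_const)
  refine hcomp.of_isClosed_subset (isClosed_polarAt P g) fun x hx => ?_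
  refine ⟨x ᵥ* C, mem_polarAt_ellipsoid.1 (polarAt_anti hC.subset g hx), ?_⟩
  simp [Matrix.vecMul_vecMul, Matrix.mul_nonsing_inv _ hC.det_pos.ne'.isUnit]

/-- A polyhedron has finitely many extreme points: they are told apart by their active
constraints. -/
theorem finite_extremePoints_polarAt {V : Set (Fin r → ℝ)} (hV : V.Finite) (d : Fin r → ℝ) :
    (Set.extremePoints ℝ (polarAt V d)).Finite := by
  refine Set.Finite.of_injOn (f := fun x => {v ∈ V | x ⬝ᵥ (v - d) = 1}) (t := 𝒫 V)
    (fun x _ v hv => hv.1) ?_ hV.finite_subsets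
  intro x hx y hy hxy
  -- A small move along `y - x` in either direction stays feasible: shared active constraints do not
  -- change and the others have slack. So `x` is a midpoint, and extremality forces `y = x`.
  have hev : ∀ v ∈ V, ∀ᶠ e : ℝ in nhdsWithin 0 (Set.Ioi 0),
      x ⬝ᵥ (v - d) + e * |(y - x) ⬝ᵥ (v - d)| ≤ 1 := by
    intro v hv
    by_cases hact : x ⬝ᵥ (v - d) = 1
    · have h2 : v ∈ {v ∈ V | y ⬝ᵥ (v - d) = 1} := by
        have : v ∈ {v ∈ V | x ⬝ᵥ (v - d) = 1} := ⟨hv, hact⟩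
        exact (Set.ext_iff.1 hxy v).1 this
      refine Filter.Eventually.of_forall fun e => ?_
      rw [sub_dotProduct, h2.2, hact]
      simp
    · have hlt : x ⬝ᵥ (v - d) < 1 := lt_of_le_of_ne (hx.1 v hv) hact
      have hcont : Continuous fun e : ℝ => x ⬝ᵥ (v - d) + e * |(y - x) ⬝ᵥ (v - d)| := by
        fun_prop
      have := (hcont.tendsto 0).eventually_lt_const (u := 1) (by simpa using hlt)
      exact (this.filter_mono nhdsWithin_le_nhds).mono fun e he => he.le
  obtain ⟨e, he, he0⟩ := (((Filter.eventually_all_finite hV).2 hev).and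
    self_mem_nhdsWithin).exists
  have he0 : (0 : ℝ) < e := he0
  have hmem : ∀ s : ℝ, |s| ≤ e → x + s • (y - x) ∈ polarAt V d := by
    intro s hs v hv
    rw [add_dotProduct, smul_dotProduct, smul_eq_mul]
    refine le_trans (add_le_add_right ?_ _) (he v hv)
    refine (le_abs_self _).trans ?_
    rw [abs_mul]
    gcongr
  have hseg : x ∈ openSegment ℝ (x + (-e) • (y - x)) (x + e • (y - x)) :=
    ⟨1 / 2, 1 / 2, by norm_num, by norm_num, by norm_num, by module⟩
  have := ((mem_extremePoints.1 hx).2 _ (hmem (-e) (by rw [abs_neg, abs_of_pos he0])) _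
    (hmem e (abs_of_pos he0).le) hseg).2
  have h0 : e • (y - x) = 0 := by simpa using this
  exact (sub_eq_zero.1 ((smul_eq_zero_iff_right he0.ne').1 h0)).symm

/-- Points outside a closed convex set are separated from it by its polar. -/
theorem exists_mem_polarAt_one_lt {P : Set (Fin r → ℝ)} (hconv : Convex ℝ P) (hcl : IsClosed P)
    {g x : Fin r → ℝ} (hg : g ∈ P) (hx : x ∉ P) :
    ∃ y ∈ polarAt P g, 1 < y ⬝ᵥ (x - g) := by
  obtain ⟨f, u, hf, hu⟩ := geometric_hahn_banach_closed_point hconv hcl hx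
  have hdot : ∀ z, f z = (fun i => f (Pi.single i 1)) ⬝ᵥ z := by
    intro z
    have := LinearMap.pi_apply_eq_sum_univ (f : (Fin r → ℝ) →ₗ[ℝ] ℝ) z
    simp only [ContinuousLinearMap.coe_coe, smul_eq_mul] at this
    rw [this]
    simp only [dotProduct]
    refine Finset.sum_congr rfl fun i _ => ?_
    rw [mul_comm]
    congr 2
    ext j
    simp [Pi.single_apply, eq_comm]
  have hpos : 0 < u - f g := sub_pos.2 (hf g hg)
  refine ⟨(u - f g)⁻¹ • fun i => f (Pi.single i 1), fun z hz => ?_, ?_⟩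
  · rw [smul_dotProduct, ← hdot, smul_eq_mul, map_sub, inv_mul_le_iff₀ hpos]
    linarith [hf z hz]
  · rw [smul_dotProduct, ← hdot, smul_eq_mul, map_sub, lt_inv_mul_iff₀ hpos]
    linarith

/-- By Krein–Milman, `x ↦ x ᵥ* A` maps the whole polar into itself. A polar vector separating `A *ᵥ
p` from `P` would be pulled back to one violated at `p`. -/
theorem mapsTo_of_mapsTo_extremePoints_polarAt {P : Set (Fin r → ℝ)} (hconv : Convex ℝ P)
    (hcl : IsClosed P) {g : Fin r → ℝ} (hg : g ∈ P) (hcomp : IsCompact (polarAt P g))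
    {A : Matrix (Fin r) (Fin r) ℝ} (hAg : A *ᵥ g = g)
    (hA : Set.MapsTo (fun x => x ᵥ* A) (Set.extremePoints ℝ (polarAt P g)) (polarAt P g)) :
    Set.MapsTo (fun x => A *ᵥ x) P P := by
  intro p hp
  by_contra hAp
  obtain ⟨y, hy, hy1⟩ := exists_mem_polarAt_one_lt hconv hcl hg hAp
  have hcont : Continuous fun x : Fin r → ℝ => x ᵥ* A :=
    continuous_id.matrix_vecMul continuous_const
  have hpre : polarAt P g ⊆ (fun x => x ᵥ* A) ⁻¹' polarAt P g := by
    conv_lhs => rw [← closure_convexHull_extremePoints hcomp (convex_polarAt P g)]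
    refine closure_minimal (convexHull_min hA ?_) ((isClosed_polarAt P g).preimage hcont)
    exact (convex_polarAt P g).linear_preimage (Matrix.vecMulLinear A)
  have h1 : (y ᵥ* A) ⬝ᵥ (p - g) ≤ 1 := hpre hy p hp
  have hAg' : y ⬝ᵥ (A *ᵥ p - g) = (y ᵥ* A) ⬝ᵥ (p - g) := by
    rw [← Matrix.dotProduct_mulVec, Matrix.mulVec_sub, hAg]
  change 1 < y ⬝ᵥ (A *ᵥ p - g) at hy1
  linarith

/-- The polar of the ellipsoid is a sublevel set of the quadratic form of `C * Cᵀ`, which the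
homeomorphism `x ↦ x ᵥ* A` preserves. -/
theorem vecMul_mem_frontier_polarAt_ellipsoid {A C : Matrix (Fin r) (Fin r) ℝ} {g x : Fin r → ℝ}
    (hA : IsUnit A.det) (h : (A * C) * (A * C)ᵀ = C * Cᵀ)
    (hx : x ∈ frontier (polarAt (ellipsoid C g) g)) :
    x ᵥ* A ∈ frontier (polarAt (ellipsoid C g) g) := by
  let e : (Fin r → ℝ) ≃ₜ (Fin r → ℝ) :=
    { toFun := fun x => x ᵥ* A
      invFun := fun x => x ᵥ* A⁻¹
      left_inv := fun x => by simp [Matrix.vecMul_vecMul, Matrix.mul_nonsing_inv _ hA]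
      right_inv := fun x => by simp [Matrix.vecMul_vecMul, Matrix.nonsing_inv_mul _ hA]
      continuous_toFun := continuous_id.matrix_vecMul continuous_const
      continuous_invFun := continuous_id.matrix_vecMul continuous_const }
  have key : ∀ (M : Matrix (Fin r) (Fin r) ℝ) (z : Fin r → ℝ),
      (z ᵥ* M) ⬝ᵥ (z ᵥ* M) = z ⬝ᵥ ((M * Mᵀ) *ᵥ z) := by
    intro M z
    rw [← Matrix.mulVec_mulVec, Matrix.dotProduct_mulVec, Matrix.mulVec_transpose]
  have hpre : e ⁻¹' polarAt (ellipsoid C g) g = polarAt (ellipsoid C g) g := by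
    ext z
    rw [Set.mem_preimage, mem_polarAt_ellipsoid, mem_polarAt_ellipsoid]
    change ((z ᵥ* A) ᵥ* C) ⬝ᵥ ((z ᵥ* A) ᵥ* C) ≤ 1 ↔ _
    rw [Matrix.vecMul_vecMul, key, key, h]
  have := e.preimage_frontier (polarAt (ellipsoid C g) g)
  rw [hpre] at this
  exact (Set.ext_iff.1 this x).2 hx

end Polars

/-! ### Optima of the Det-Max problem and symmetries of the polytope. -/

section DetMax

variable {r : ℕ}

theorem convCols_mul {N : ℕ} (A : Matrix (Fin r) (Fin r) ℝ) (S : Matrix (Fin r) (Fin N) ℝ) :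
    convCols (A * S) = (fun x => A *ᵥ x) '' convCols S := by
  change convexHull ℝ _ = A.mulVecLin '' convexHull ℝ _
  rw [A.mulVecLin.image_convexHull, ← Set.range_comp]
  rfl

theorem col_mem_convCols {N : ℕ} (S : Matrix (Fin r) (Fin N) ℝ) (j : Fin N) :
    S.col j ∈ convCols S := subset_convexHull ℝ _ ⟨j, rfl⟩

theorem det_mul_transpose_nonneg {N : ℕ} (S : Matrix (Fin r) (Fin N) ℝ) :
    0 ≤ (S * Sᵀ).det := by
  have := (Matrix.posSemidef_self_mul_conjTranspose S).det_nonneg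
  rwa [Matrix.conjTranspose_eq_transpose_of_trivial] at this

/-- A vector orthogonal to all columns is orthogonal to a nondegenerate ellipsoid, center included,
hence zero. -/
theorem det_mul_transpose_pos {N : ℕ} {S : Matrix (Fin r) (Fin N) ℝ}
    {C : Matrix (Fin r) (Fin r) ℝ} {g : Fin r → ℝ} (hC : IsUnit C.det)
    (h : ellipsoid C g ⊆ convCols S) : 0 < (S * Sᵀ).det := by
  have hinj : Function.Injective S.vecMul := by
    refine (injective_iff_map_eq_zero S.vecMulLinear).2 fun v hv => ?_
    have hcol : ∀ y ∈ convCols S, v ⬝ᵥ y = 0 := by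
      have hc : Convex ℝ {y | v ⬝ᵥ y = 0} := by
        intro x hx y hy a b _ _ _
        have hx' : v ⬝ᵥ x = 0 := hx
        have hy' : v ⬝ᵥ y = 0 := hy
        simp [dotProduct_add, hx', hy']
      refine fun y hy => convexHull_min ?_ hc hy
      rintro _ ⟨j, rfl⟩
      exact congrFun hv j
    have hg : v ⬝ᵥ g = 0 := by
      simpa using hcol _ (h ⟨0, by simp, rfl⟩)
    have hvC : v ᵥ* C = 0 := by
      ext i
      have := hcol _ (h ⟨Pi.single i 1, by simp, rfl⟩)
      rw [dotProduct_add, hg, add_zero, Matrix.dotProduct_mulVec] at this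
      simpa using this
    have := congrArg (fun w => w ᵥ* C⁻¹) hvC
    simpa [Matrix.vecMul_vecMul, Matrix.mul_nonsing_inv _ hC] using this
  have := (Matrix.PosDef.mul_conjTranspose_self S hinj).det_pos
  rwa [Matrix.conjTranspose_eq_transpose_of_trivial] at this

theorem exists_left_inverse_of_rank_eq {M : ℕ} {H : Matrix (Fin M) (Fin r) ℝ}
    (h : H.rank = r) : ∃ L : Matrix (Fin r) (Fin M) ℝ, L * H = 1 := by
  have hli : LinearIndependent ℝ H.col := by
    rw [linearIndependent_iff_card_eq_finrank_span, Fintype.card_fin]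
    exact h.symm.trans H.rank_eq_finrank_span_cols
  have hpd := (Matrix.PosDef.conjTranspose_mul_self H (Matrix.mulVec_injective_iff.2 hli)).det_pos
  exact ⟨(Hᴴ * H)⁻¹ * Hᴴ, by
    rw [Matrix.mul_assoc, Matrix.nonsing_inv_mul _ hpd.ne'.isUnit]⟩

theorem exists_right_inverse_of_det_pos {N : ℕ} {S : Matrix (Fin r) (Fin N) ℝ}
    (h : 0 < (S * Sᵀ).det) : ∃ R : Matrix (Fin N) (Fin r) ℝ, S * R = 1 :=
  ⟨Sᵀ * (S * Sᵀ)⁻¹, by rw [← Matrix.mul_assoc, Matrix.mul_nonsing_inv _ h.ne'.isUnit]⟩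

/-- Two full rank factorizations of one matrix differ by an invertible matrix. -/
theorem exists_eq_mul_of_mul_eq_mul {M N : ℕ} {H Hg : Matrix (Fin M) (Fin r) ℝ}
    {S Sg : Matrix (Fin r) (Fin N) ℝ} (h : Hg * Sg = H * S) (hHg : Hg.rank = r)
    (hSg : 0 < (Sg * Sgᵀ).det) (hS : 0 < (S * Sᵀ).det) :
    ∃ A : Matrix (Fin r) (Fin r) ℝ, IsUnit A.det ∧ S = A * Sg ∧ H = Hg * A⁻¹ := by
  obtain ⟨L, hL⟩ := exists_left_inverse_of_rank_eq hHg
  obtain ⟨R, hR⟩ := exists_right_inverse_of_det_pos hS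
  -- `L * H` is the inverse of the matrix sought; it is invertible because `Sg` has full row rank.
  have hB : Sg = L * H * S := by
    rw [Matrix.mul_assoc, ← h, ← Matrix.mul_assoc, hL, Matrix.one_mul]
  have hu : IsUnit (L * H).det := by
    refine Ne.isUnit fun h0 => hSg.ne' ?_
    rw [hB, Matrix.transpose_mul _ S, Matrix.mul_assoc, Matrix.det_mul, h0, zero_mul]
  refine ⟨(L * H)⁻¹, Matrix.isUnit_nonsing_inv_det _ hu, ?_, ?_⟩
  · nth_rewrite 1 [hB]
    rw [← Matrix.mul_assoc, Matrix.nonsing_inv_mul _ hu, Matrix.one_mul]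
  · rw [Matrix.nonsing_inv_nonsing_inv _ hu]
    have := congrArg (· * R) h
    nth_rewrite 1 [hB] at this
    simp only [Matrix.mul_assoc, hR, Matrix.mul_one] at this
    exact this.symm

theorem det_mul_mul_transpose {N : ℕ} (A : Matrix (Fin r) (Fin r) ℝ)
    (S : Matrix (Fin r) (Fin N) ℝ) :
    (A * S * (A * S)ᵀ).det = |A.det| ^ 2 * (S * Sᵀ).det := by
  rw [Matrix.transpose_mul, Matrix.mul_assoc, ← Matrix.mul_assoc S, Matrix.det_mul,
    Matrix.det_mul, Matrix.det_transpose, sq_abs]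
  ring

theorem ellipsoid_mul_subset_of_col_mem {P : Set (Fin r → ℝ)} (hP : Convex ℝ P) {N : ℕ}
    {S : Matrix (Fin r) (Fin N) ℝ} {A C : Matrix (Fin r) (Fin r) ℝ} {g : Fin r → ℝ}
    (hE : ellipsoid C g ⊆ convCols S) (hcol : ∀ j, (A * S).col j ∈ P) :
    ellipsoid (A * C) (A *ᵥ g) ⊆ P := by
  rw [← image_mulVec_ellipsoid]
  refine (Set.image_mono hE).trans ?_
  rw [← convCols_mul]
  exact convexHull_min (Set.range_subset_iff.2 hcol) hP

theorem IsMVIE.abs_det_le_one {P : Set (Fin r → ℝ)} {A C : Matrix (Fin r) (Fin r) ℝ}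
    {g h : Fin r → ℝ} (hC : IsMVIE P C g) (hA : ellipsoid (A * C) h ⊆ P) : |A.det| ≤ 1 := by
  have := hC.abs_det_le hA
  rw [Matrix.det_mul, abs_mul, abs_of_pos hC.det_pos] at this
  exact le_of_mul_le_mul_right (by simpa using this) hC.det_pos

/-- The ground truth of a sufficiently scattered model is an optimum. -/
theorem det_le_of_isFeasible {P : Set (Fin r → ℝ)} (hP : Convex ℝ P) {M N : ℕ}
    {Y : Matrix (Fin M) (Fin N) ℝ} {H Hg : Matrix (Fin M) (Fin r) ℝ}
    {S Sg : Matrix (Fin r) (Fin N) ℝ} (hY : Y = Hg * Sg) (hHg : Hg.rank = r)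
    {C : Matrix (Fin r) (Fin r) ℝ} {g : Fin r → ℝ} (hC : IsMVIE P C g)
    (hE : ellipsoid C g ⊆ convCols Sg) (hf : IsFeasible P Y H S) :
    (S * Sᵀ).det ≤ (Sg * Sgᵀ).det := by
  have hSg := det_mul_transpose_pos hC.det_pos.ne'.isUnit hE
  rcases (det_mul_transpose_nonneg S).eq_or_lt with h0 | h0
  · exact h0 ▸ hSg.le
  obtain ⟨A, -, rfl, -⟩ := exists_eq_mul_of_mul_eq_mul (hY ▸ hf.1) hHg hSg h0
  have hA := hC.abs_det_le_one (ellipsoid_mul_subset_of_col_mem hP hE hf.2)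
  rw [det_mul_mul_transpose]
  exact mul_le_of_le_one_left hSg.le (pow_le_one₀ (abs_nonneg _) hA)

/-- Invariance uses the order `Π D` and identifiability `D Π`; this passes between them. -/
theorem permMatrix_mul_diagonal (σ : Equiv.Perm (Fin r)) (d : Fin r → ℝ) :
    σ.permMatrix ℝ * Matrix.diagonal d = Matrix.diagonal (d ∘ σ) * σ.permMatrix ℝ := by
  ext i j
  rw [Matrix.mul_diagonal, Matrix.diagonal_mul, Equiv.Perm.permMatrix, PEquiv.toMatrix_apply]
  by_cases h : σ i = j
  · simp [h]
  · simp [h]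

theorem permMatrix_inv (σ : Equiv.Perm (Fin r)) : (σ.permMatrix ℝ)⁻¹ = (σ.permMatrix ℝ)ᵀ := by
  refine Matrix.inv_eq_right_inv ?_
  rw [Matrix.transpose_permMatrix, ← Matrix.permMatrix_mul, inv_mul_cancel, Matrix.permMatrix_one]

theorem image_mulVec_extremePoints {A : Matrix (Fin r) (Fin r) ℝ} (hA : IsUnit A.det)
    (P : Set (Fin r → ℝ)) : (fun x => A *ᵥ x) '' Set.extremePoints ℝ P =
      Set.extremePoints ℝ ((fun x => A *ᵥ x) '' P) :=
  image_extremePoints (A.toLinearEquiv' ((Matrix.isUnit_iff_isUnit_det A).2 hA).invertible) P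

/-- The linear map that relates an optimum to the ground truth permutes the extreme points. -/
theorem image_extremePoints_eq_of_col_mem {P : Set (Fin r → ℝ)} (hP : IsPolytope P) {N : ℕ}
    {S : Matrix (Fin r) (Fin N) ℝ} (hS : IsSufficientlyScattered P S)
    {A : Matrix (Fin r) (Fin r) ℝ} (hcol : ∀ j, (A * S).col j ∈ P) (hdet : 1 ≤ |A.det|) :
    (fun x => A *ᵥ x) '' Set.extremePoints ℝ P = Set.extremePoints ℝ P := by
  obtain ⟨V, hV, rfl⟩ := hP
  obtain ⟨C, g, hC, -, hE, hext⟩ := hS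
  set P := convexHull ℝ V with hPV
  have hconv : Convex ℝ P := convex_convexHull ℝ V
  have hcl : IsClosed P := hV.isClosed_convexHull ℝ
  have hsub := ellipsoid_mul_subset_of_col_mem hconv hE hcol
  have hAu : IsUnit A.det := by
    refine Ne.isUnit fun h0 => ?_
    rw [h0, abs_zero] at hdet
    linarith
  obtain ⟨hAC, hAg⟩ := hC.eq_of_image_subset hconv hsub
    (le_antisymm (hC.abs_det_le_one hsub) hdet)
  have hg : g ∈ P := hC.subset ⟨0, by simp, by simp⟩
  have hAg' : A⁻¹ *ᵥ g = g := by
    nth_rewrite 1 [← hAg]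
    rw [Matrix.mulVec_mulVec, Matrix.nonsing_inv_mul _ hAu, Matrix.one_mulVec]
  have hmaps : Set.MapsTo (fun x => x ᵥ* A) (Set.extremePoints ℝ (polarAt P g))
      (Set.extremePoints ℝ (polarAt P g)) := by
    intro x hx
    have hx' := hx
    rw [← hext] at hx' ⊢
    refine ⟨fun y hy => ?_, vecMul_mem_frontier_polarAt_ellipsoid hAu hAC hx'.2⟩
    have hAy : A *ᵥ y ∈ P := by
      have : A *ᵥ y ∈ convCols (A * S) := by
        rw [convCols_mul]
        exact ⟨y, hy, rfl⟩
      exact convexHull_min (Set.range_subset_iff.2 hcol) hconv this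
    have := hx.1 _ hAy
    nth_rewrite 1 [← hAg] at this
    rwa [← Matrix.mulVec_sub, Matrix.dotProduct_mulVec] at this
  have hfin : (Set.extremePoints ℝ (polarAt P g)).Finite := by
    rw [hPV, polarAt_convexHull]
    exact finite_extremePoints_polarAt hV g
  have hcancel : ∀ x : Fin r → ℝ, (x ᵥ* A) ᵥ* A⁻¹ = x := fun x => by
    rw [Matrix.vecMul_vecMul, Matrix.mul_nonsing_inv _ hAu, Matrix.vecMul_one]
  -- An injective self-map of a finite set is onto, which gives the inclusion for `A⁻¹` as well.
  have hsurj := ((hfin.injOn_iff_bijOn_of_mapsTo hmaps).1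
    (Function.LeftInverse.injective (g := fun x => x ᵥ* A⁻¹) hcancel).injOn).surjOn
  have hmaps' : Set.MapsTo (fun x => x ᵥ* A⁻¹) (Set.extremePoints ℝ (polarAt P g))
      (polarAt P g) := by
    intro x hx
    obtain ⟨y, hy, rfl⟩ := hsurj hx
    change (y ᵥ* A) ᵥ* A⁻¹ ∈ polarAt P g
    rw [hcancel]
    exact hy.1
  have h1 := mapsTo_of_mapsTo_extremePoints_polarAt hconv hcl hg hC.isCompact_polarAt hAg
    (hmaps.mono_right fun _ h => h.1)
  have h2 := mapsTo_of_mapsTo_extremePoints_polarAt hconv hcl hg hC.isCompact_polarAt hAg' hmaps'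
  rw [image_mulVec_extremePoints hAu]
  congr 1
  refine (Set.image_subset_iff.2 h1).antisymm fun p hp => ⟨_, h2 hp, ?_⟩
  simp [Matrix.mul_nonsing_inv _ hAu]

theorem isDetMaxIdentifiable_of_isPermSignOnlyInvariant {P : Set (Fin r → ℝ)}
    (hP : IsPolytope P) (h : IsPermSignOnlyInvariant (Set.extremePoints ℝ P)) :
    IsDetMaxIdentifiable P := by
  rintro M N Y Hg Sg hgen hSg H S ⟨hf, hopt⟩
  have hSg' := hSg
  obtain ⟨C, g, hC, -, hE, -⟩ := hSg'
  have hpos := det_mul_transpose_pos hC.det_pos.ne'.isUnit hE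
  have hle := hopt Hg Sg ⟨hgen.eq_mul, hgen.col_mem⟩
  obtain ⟨A, hAu, rfl, rfl⟩ := exists_eq_mul_of_mul_eq_mul (hgen.eq_mul ▸ hf.1) hgen.rank_eq hpos
    (hpos.trans_le hle)
  have hdet : 1 ≤ |A.det| := by
    rw [det_mul_mul_transpose, le_mul_iff_one_le_left hpos] at hle
    exact (one_le_sq_iff₀ (abs_nonneg _)).1 hle
  obtain ⟨σ, _, ⟨d, hd, rfl⟩, rfl⟩ := h A (image_extremePoints_eq_of_col_mem hP hSg hf.2 hdet)
  refine ⟨σ, _, ⟨d ∘ σ, fun i => hd (σ i), rfl⟩, ?_, ?_⟩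
  · rw [permMatrix_mul_diagonal, Matrix.mul_inv_rev, permMatrix_inv, Matrix.mul_assoc]
  · rw [permMatrix_mul_diagonal]

theorem IsPolytope.convexHull_extremePoints {P : Set (Fin r → ℝ)} (hP : IsPolytope P) :
    convexHull ℝ (Set.extremePoints ℝ P) = P := by
  obtain ⟨V, hV, rfl⟩ := hP
  have hfin : (Set.extremePoints ℝ (convexHull ℝ V)).Finite :=
    hV.subset extremePoints_convexHull_subset
  rw [← (hfin.isClosed_convexHull ℝ).closure_eq]
  exact closure_convexHull_extremePoints (hV.isCompact_convexHull ℝ) (convex_convexHull ℝ V)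

theorem isPermSignOnlyInvariant_of_isDetMaxIdentifiable {P : Set (Fin r → ℝ)}
    (hP : IsPolytope P) {N : ℕ} {S : Matrix (Fin r) (Fin N) ℝ}
    (hS : IsSufficientlyScattered P S) (h : IsDetMaxIdentifiable P) :
    IsPermSignOnlyInvariant (Set.extremePoints ℝ P) := by
  intro A hA
  have hconv : Convex ℝ P := by
    rw [← hP.convexHull_extremePoints]
    exact convex_convexHull ℝ _
  have hAP : (fun x => A *ᵥ x) '' P = P := by
    have := A.mulVecLin.image_convexHull (Set.extremePoints ℝ P)
    change (fun x => A *ᵥ x) '' _ = convexHull ℝ ((fun x => A *ᵥ x) '' _) at this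
    rwa [hA, hP.convexHull_extremePoints] at this
  have hS' := hS
  obtain ⟨C, g, hC, hSP, hE, -⟩ := hS'
  have hpos := det_mul_transpose_pos hC.det_pos.ne'.isUnit hE
  obtain ⟨R, hR⟩ := exists_right_inverse_of_det_pos hpos
  -- the columns of `S` are images under `A` of the columns of a matrix `T`
  have hpre : ∀ j, ∃ t ∈ P, A *ᵥ t = S.col j := fun j => by
    have := hSP (col_mem_convCols S j)
    rw [← hAP] at this
    exact this
  choose t htP ht using hpre
  have hT : S = A * (Matrix.of t)ᵀ := by
    ext i j
    exact (congrFun (ht j) i).symm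
  have hAu : IsUnit A.det := by
    refine Ne.isUnit fun h0 => hpos.ne' ?_
    rw [hT, det_mul_mul_transpose, h0]
    simp
  have hcolS : ∀ j, S.col j ∈ P := fun j => hSP (col_mem_convCols S j)
  have hcol : ∀ j, (A * S).col j ∈ P := fun j => by
    rw [← hAP]
    exact ⟨_, hcolS j, rfl⟩
  have hTS : (Matrix.of t)ᵀ = A⁻¹ * S := by
    rw [hT, ← Matrix.mul_assoc, Matrix.nonsing_inv_mul _ hAu, Matrix.one_mul]
  have hcol' : ∀ j, (A⁻¹ * S).col j ∈ P := fun j => by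
    rw [← hTS]
    exact htP j
  -- `A⁻¹` also keeps the columns of `S` in `P`, so the volume bound applies to it.
  have hdet : 1 ≤ |A.det| := by
    have := hC.abs_det_le_one (ellipsoid_mul_subset_of_col_mem hconv hE hcol')
    rw [Matrix.det_nonsing_inv, Ring.inverse_eq_inv', abs_inv] at this
    exact (inv_le_one₀ (abs_pos.2 hAu.ne_zero)).1 this
  have hrN : r ≤ N := by
    have h1 := Matrix.rank_mul_le_left S R
    rw [hR, Matrix.rank_one, Fintype.card_fin] at h1
    simpa using h1.trans (Matrix.rank_le_card_width S)
  -- The simplest model, `Y = S` and `Hg = 1`, already detects `A`, through the optimum `(A⁻¹, A *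
  -- S)`.
  have hgen : IsGenerativeModel P S (1 : Matrix (Fin r) (Fin r) ℝ) S :=
    ⟨(Matrix.one_mul S).symm, by simp, by simpa using hrN, hcolS⟩
  obtain ⟨σ, _, ⟨d, hd, rfl⟩, -, hAS⟩ := h r N S 1 S hgen hS A⁻¹ (A * S)
    ⟨⟨by rw [← Matrix.mul_assoc, Matrix.nonsing_inv_mul _ hAu, Matrix.one_mul], hcol⟩,
      fun H' S' hf => by
        refine (det_le_of_isFeasible hconv hgen.eq_mul hgen.rank_eq hC hE hf).trans ?_
        rw [det_mul_mul_transpose]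
        exact le_mul_of_one_le_left hpos.le (one_le_pow₀ hdet)⟩
  have hA' : A = Matrix.diagonal d * σ.permMatrix ℝ := by
    have := congrArg (· * R) hAS
    simpa only [Matrix.mul_assoc, hR, Matrix.mul_one] using this
  refine ⟨σ, _, ⟨d ∘ σ.symm, fun i => hd (σ.symm i), rfl⟩, ?_⟩
  rw [hA', permMatrix_mul_diagonal, Function.comp_assoc, Equiv.symm_comp_self, Function.comp_id]

end DetMax

theorem theorem6 {r : ℕ} (P : Set (Fin r → ℝ)) (hP : IsPolytope P) :
    (IsPermSignOnlyInvariant (Set.extremePoints ℝ P) → IsDetMaxIdentifiable P) ∧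
    ((∃ (N : ℕ) (S : Matrix (Fin r) (Fin N) ℝ), IsSufficientlyScattered P S) →
      (IsDetMaxIdentifiable P ↔ IsPermSignOnlyInvariant (Set.extremePoints ℝ P))) :=
  ⟨isDetMaxIdentifiable_of_isPermSignOnlyInvariant hP, fun ⟨_, _, hS⟩ =>
    ⟨isPermSignOnlyInvariant_of_isDetMaxIdentifiable hP hS,
      isDetMaxIdentifiable_of_isPermSignOnlyInvariant hP⟩⟩
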